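/- A probabilistic labelled transition system (pLTS) consists of a set $S$ of states, a set $\mathit{Act}$ of actions and a transition relation $\to\ \subseteq S\times \mathit{Act}\times\mathcal D(S)$, where $\mathcal D(S)$ is the set of finitely supported probability distributions on $S$; write $s\xrightarrow{a}\Delta$ for $(s,a,\Delta)\in\ \to$, and $\lceil\Delta\rceil$ for the support of $\Delta$. It is finitary if $S$ is finite and each state has finitely many outgoing transitions. For $R\subseteq S\times S$, the lifting $R^\dagger\subseteq\mathcal D(S)\times\mathcal D(S)$ is the smallest relation that relates the point distributions of any two $R$-related states and is closed under finite convex combinations ($\Delta_i\,R^\dagger\,\Theta_i$ for all $i$ implies $\sum_i p_i\Delta_i\ R^\dagger\ \sum_i p_i\Theta_i$). $R$ is a probabilistic simulation if $s\,R\,t$ and $s\xrightarrow{a}\Delta$ imply that there is $\Theta$ with $t\xrightarrow{a}\Theta$ and $\Delta\,R^\dagger\,\Theta$; it is a probabilistic bisimulation if $R$ and $R^{-1}$ are probabilistic simulations; $\sim$ is the largest probabilistic bisimulation. For $\Delta,\Theta\in\mathcal D(S)$ with $S$ finite and $R\subseteq S\times S$, let $\mathcal N(\Delta,\Theta,R)$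 be the network with nodes $S\cup\{s' : s\in S\}\cup\{\bot,\top\}$ (the $s'$ are distinct copies of the states, $\bot$ is the source, $\top$ the sink), with edges $(s,t')$ of capacity $1$ for $s\,R\,t$, edges $(\bot,s)$ of capacity $\Delta(s)$ and edges $(t',\top)$ of capacity $\Theta(t)$. $\mathrm{Check}(\Delta,\Theta,R)$ computes the maximum flow $F$ of this network, and returns false if $F<1$ and true otherwise; computing $F$ counts as one step. The algorithm $\mathrm{Bisim}(s,t)$ has three global sets of state pairs and works as follows. \begin{itemize} \item $\mathrm{Bisim}(s,t)$: set $\mathit{NotBisim}:=\emptyset$ and return $\mathrm{Bis}(s,t)$. \item $\mathrm{Bis}(s,t)$: set $\mathit{Visited}:=\emptyset$, $\mathit{Assumed}:=\emptyset$ and return $\mathrm{Match}(s,t)$; if this raises the exception $\mathit{WrongAssumption}$, run $\mathrm{Bis}(s,t)$ again, keeping the current $\mathit{NotBisim}$. \item $\mathrm{Match}(s,t)$: add $(s,t)$ to $\mathit{Visited}$; compute $b:=\bigwedge_{a}\mathrm{MatchAction}(s,t,a)$; if $b$ is false, add $(s,t)$ to $\mathit{NotBisim}$ and then, if $(s,t)\in\mathit{Assumed}$,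 raise $\mathit{WrongAssumption}$; return $b$. \item $\mathrm{MatchAction}(s,t,a)$: for all $s\xrightarrow{a}\Delta_i$ and all $t\xrightarrow{a}\Theta_j$ compute $b_{ij}:=\mathrm{MatchDistribution}(\Delta_i,\Theta_j)$; return $\bigl(\bigwedge_i\bigvee_j b_{ij}\bigr)\wedge\bigl(\bigwedge_j\bigvee_i b_{ij}\bigr)$. \item $\mathrm{MatchDistribution}(\Delta,\Theta)$: compute $R:=\{(u,v)\in\lceil\Delta\rceil\times\lceil\Theta\rceil : \mathrm{Close}(u,v)=\text{true}\}$; return $\mathrm{Check}(\Delta,\Theta,R)$. \item $\mathrm{Close}(s,t)$: if $(s,t)\in\mathit{NotBisim}$, return false; otherwise, if $(s,t)\in\mathit{Visited}$, add $(s,t)$ to $\mathit{Assumed}$ and return true; otherwise return $\mathrm{Match}(s,t)$. \end{itemize} The loops over actions, transitions and pairs of states run in an arbitrary fixed order; the loop over actions runs through finitely many actions, among them all that are enabled in $s$ or $t$. Theorem. Let $s_0,t_0$ be states of a finitary pLTS. Then $\mathrm{Bisim}(s_0,t_0)$ terminates, and it returns true if and only if $s_0\sim t_0$. -/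

import Mathlib

open Convexity
open scoped Classical

universe u v

/-! ### Distributions and lifting of relations -/

/-- Finitely supported probability distributions over `S`. -/
abbrev FinDist (S : Type u) : Type u := StdSimplex ℝ S

/-- The lifting of a relation on states to a relation on distributions: the smallest relation
that relates point distributions of related states and is closed under finite convex
combinations. -/
inductive Lift {S : Type u} {T : Type v} (R : S → T → Prop) : FinDist S → FinDist T → Prop
  | point {s : S} {t : T} (h : R s t) : Lift R (StdSimplex.single s) (StdSimplex.single t)
  | comb {n : ℕ} (p : StdSimplex ℝ (Fin n)) (Δ : Fin n → FinDist S) (Θ : Fin n → FinDist T)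
      (h : ∀ i, Lift R (Δ i) (Θ i)) : Lift R (iConvexComb p Δ) (iConvexComb p Θ)

/-! ### Probabilistic labelled transition systems and bisimilarity -/

/-- A probabilistic labelled transition system with state set `S` and action set `Act`;
`L.Trans s a Δ` means `s` has an `a`-transition to the distribution `Δ`. -/
structure PLTS (S : Type u) (Act : Type v) where
  Trans : S → Act → FinDist S → Prop

namespace PLTS

variable {S : Type u} {Act : Type v}

/-- Every state has only finitely many outgoing transitions. -/
def FinitelyBranching (L : PLTS S Act) : Prop :=
  ∀ s, {x : Act × FinDist S | L.Trans s x.1 x.2}.Finite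

/-- Finitely many states, and finitely branching. -/
def Finitary (L : PLTS S Act) : Prop :=
  Finite S ∧ L.FinitelyBranching

/-- Probabilistic simulations. -/
def IsSimulation (L : PLTS S Act) (R : S → S → Prop) : Prop :=
  ∀ s t, R s t → ∀ a Δ, L.Trans s a Δ → ∃ Θ, L.Trans t a Θ ∧ Lift R Δ Θ

/-- Probabilistic bisimulations. -/
def IsBisimulation (L : PLTS S Act) (R : S → S → Prop) : Prop :=
  L.IsSimulation R ∧ L.IsSimulation (fun s t => R t s)

/-- Probabilistic bisimilarity: the union of all probabilistic bisimulations. -/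
def Bisimilar (L : PLTS S Act) (s t : S) : Prop :=
  ∃ R, L.IsBisimulation R ∧ R s t

end PLTS

theorem Lift.mono {S : Type u} {T : Type v} {R R' : S → T → Prop} (h : ∀ s t, R s t → R' s t)
    {Δ : FinDist S} {Θ : FinDist T} (hl : Lift R Δ Θ) : Lift R' Δ Θ := by
  induction hl with
  | point hs => exact .point (h _ _ hs)
  | comb p Δ Θ _ ih => exact .comb p Δ Θ ih

/-- Probabilistic bisimilarity is the largest probabilistic bisimulation. -/
theorem PLTS.isGreatest_bisimilar {S : Type u} {Act : Type v} (L : PLTS S Act) :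
    IsGreatest {R | L.IsBisimulation R} L.Bisimilar := by
  refine ⟨⟨?_, ?_⟩, fun R hR s t h => ⟨R, hR, h⟩⟩
  · rintro s t ⟨R, hR, h⟩ a Δ hs
    obtain ⟨Θ, ht, hl⟩ := hR.1 s t h a Δ hs
    exact ⟨Θ, ht, hl.mono fun s t h => ⟨R, hR, h⟩⟩
  · rintro s t ⟨R, hR, h⟩ a Δ hs
    obtain ⟨Θ, ht, hl⟩ := hR.2 s t h a Δ hs
    exact ⟨Θ, ht, hl.mono fun s t h => ⟨R, hR, h⟩⟩

/-! ### Networks and maximum flow -/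

/-- A network: a finite directed graph on the node set `N` with a source, a sink and
a non-negative capacity for every edge. -/
structure Network (N : Type u) where
  edges : Finset (N × N)
  source : N
  sink : N
  source_ne_sink : source ≠ sink
  cap : N × N → ℝ
  cap_nonneg : ∀ e ∈ edges, 0 ≤ cap e

namespace Network

variable {N : Type u}

noncomputable def inflow (G : Network N) (f : N × N → ℝ) (v : N) : ℝ :=
  ∑ e ∈ G.edges with e.2 = v, f e

noncomputable def outflow (G : Network N) (f : N × N → ℝ) (v : N) : ℝ :=
  ∑ e ∈ G.edges with e.1 = v, f e

/-- Flow functions; only the values on edges matter. -/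
structure IsFlow (G : Network N) (f : N × N → ℝ) : Prop where
  nonneg : ∀ e ∈ G.edges, 0 ≤ f e
  le_cap : ∀ e ∈ G.edges, f e ≤ G.cap e
  conserved : ∀ v, v ≠ G.source → v ≠ G.sink → G.inflow f v = G.outflow f v

/-- The flow `F(f)` of a flow function. -/
noncomputable def value (G : Network N) (f : N × N → ℝ) : ℝ :=
  G.outflow f G.source - G.inflow f G.source

/-- The maximum flow. -/
noncomputable def maxFlow (G : Network N) : ℝ :=
  sSup {x | ∃ f, G.IsFlow f ∧ x = G.value f}

end Network

/-- The nodes `S ∪ S' ∪ {⊥, ⊤}`: `state s` is `s`, `copy s` is `s'`. -/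
inductive FlowNode (S : Type u) : Type u
  | source : FlowNode S
  | sink : FlowNode S
  | state (s : S) : FlowNode S
  | copy (s : S) : FlowNode S

noncomputable instance {S : Type u} [Fintype S] : Fintype (FlowNode S) where
  elems := {.source, .sink} ∪ Finset.univ.image .state ∪ Finset.univ.image .copy
  complete x := by cases x <;> simp

/-- The edges are those from `s` to `t'` for `R s t`, from `⊥` to each `s`,
and from each `s'` to `⊤`. -/
def liftEdge {S : Type u} (R : S → S → Prop) : FlowNode S × FlowNode S → Prop
  | (.state s, .copy t) => R s t
  | (.source, .state _) => True
  | (.copy _, .sink) => True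
  | _ => False

/-- The capacities (`0` on pairs that are never edges). -/
noncomputable def liftCap {S : Type u} (Δ Θ : FinDist S) : FlowNode S × FlowNode S → ℝ
  | (.state _, .copy _) => 1
  | (.source, .state s) => Δ.weights s
  | (.copy t, .sink) => Θ.weights t
  | _ => 0

/-- The network associated with two distributions and a relation. -/
noncomputable def liftNetwork {S : Type u} [Fintype S] (Δ Θ : FinDist S) (R : S → S → Prop) :
    Network (FlowNode S) where
  edges := {e | liftEdge R e}
  source := .source
  sink := .sink
  source_ne_sink := by simp
  cap := liftCap Δ Θ
  cap_nonneg := by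
    rintro ⟨x, y⟩ -
    cases x <;> cases y <;> simp [liftCap]

/-- `Check(Δ, Θ, R)`: compute the maximum flow `F` of the network;
answer "no" if `F < 1` and "yes" otherwise. -/
noncomputable def check {S : Type u} [Fintype S] (Δ Θ : FinDist S) (R : S → S → Prop) : Bool :=
  if (liftNetwork Δ Θ R).maxFlow < 1 then false else true

/-! ### Programs: global variables, one exception, possible divergence -/

/-- The global variables of the algorithm. -/
structure Store (S : Type u) where
  notBisim : Set (S × S)
  visited : Set (S × S)
  assumed : Set (S × S)

/-- The outcome of running a program for a bounded number of nested calls: the bound was hit,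
the exception `WrongAssumption` was raised, or a value was returned. -/
inductive Outcome (S : Type u) (α : Type v) : Type (max u v)
  | outOfFuel : Outcome S α
  | wrongAssumption (σ : Store S) : Outcome S α
  | ret (x : α) (σ : Store S) : Outcome S α

/-- A program that computes a value of type `α`. -/
abbrev Prog (S : Type u) (α : Type v) : Type (max u v) := Store S → Outcome S α

namespace Prog

universe w

variable {S : Type u} {α : Type v} {β : Type w}

/-- Return a value. -/
def done (x : α) : Prog S α := fun σ => .ret x σ

/-- Sequential composition. An exception aborts what follows and keeps the store. -/
def andThen (p : Prog S α) (q : α → Prog S β) : Prog S β := fun σ =>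
  match p σ with
  | .outOfFuel => .outOfFuel
  | .wrongAssumption σ' => .wrongAssumption σ'
  | .ret x σ' => q x σ'

/-- Run `body` on every entry of a list, in order, and collect the results. -/
def forEach : List α → (α → Prog S β) → Prog S (List β)
  | [], _ => done []
  | x :: l, body => (body x).andThen fun y => (forEach l body).andThen fun ys => done (y :: ys)

end Prog

/-! ### The algorithm -/

namespace PLTS

variable {S : Type u} {Act : Type v}

/-- The orders in which the loops of the algorithm run through their index sets. A list of
actions has to contain at least the actions enabled in one of the two states. -/
structure Enumeration (L : PLTS S Act) where
  actions : S → S → List Act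
  actions_nodup : ∀ s t, (actions s t).Nodup
  mem_actions : ∀ s t a Δ, L.Trans s a Δ ∨ L.Trans t a Δ → a ∈ actions s t
  transitions : S → Act → List (FinDist S)
  transitions_nodup : ∀ s a, (transitions s a).Nodup
  mem_transitions : ∀ s a Δ, Δ ∈ transitions s a ↔ L.Trans s a Δ
  pairs : FinDist S → FinDist S → List (S × S)
  pairs_nodup : ∀ Δ Θ, (pairs Δ Θ).Nodup
  mem_pairs : ∀ Δ Θ s t,
    (s, t) ∈ pairs Δ Θ ↔ s ∈ Δ.weights.support ∧ t ∈ Θ.weights.support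

/-- A finitary pLTS has an enumeration. -/
theorem Finitary.nonempty_enumeration {L : PLTS S Act} (hL : L.Finitary) :
    Nonempty L.Enumeration := by
  have hT : ∀ s a, {Δ | L.Trans s a Δ}.Finite := fun s a =>
    ((hL.2 s).image Prod.snd).subset fun Δ h => ⟨(a, Δ), h, rfl⟩
  have hA : ∀ s, {a | ∃ Δ, L.Trans s a Δ}.Finite := fun s =>
    ((hL.2 s).image Prod.fst).subset fun a ⟨Δ, h⟩ => ⟨(a, Δ), h, rfl⟩
  refine ⟨{
    actions := fun s t => ((hA s).union (hA t)).toFinset.toList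
    actions_nodup := fun _ _ => Finset.nodup_toList _
    mem_actions := ?_
    transitions := fun s a => (hT s a).toFinset.toList
    transitions_nodup := fun _ _ => Finset.nodup_toList _
    mem_transitions := by simp
    pairs := fun Δ Θ => (Δ.weights.support ×ˢ Θ.weights.support).toList
    pairs_nodup := fun _ _ => Finset.nodup_toList _
    mem_pairs := by simp }⟩
  rintro s t a Δ (h | h)
  · simpa using Or.inl ⟨Δ, h⟩
  · simpa using Or.inr ⟨Δ, h⟩

/-- `Close(s, t)`, where `call` stands for the calls of `Match`. -/
noncomputable def close (call : S → S → Prog S Bool) (s t : S) : Prog S Bool := fun σ =>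
  if (s, t) ∈ σ.notBisim then
    .ret false σ
  else if (s, t) ∈ σ.visited then
    .ret true { σ with assumed := σ.assumed ∪ {(s, t)} }
  else
    call s t σ

variable {L : PLTS S Act} [Fintype S] (E : L.Enumeration) (call : S → S → Prog S Bool)

/-- `MatchDistribution(Δ, Θ)`. -/
noncomputable def matchDistribution (Δ Θ : FinDist S) : Prog S Bool :=
  (Prog.forEach (E.pairs Δ Θ) fun p =>
    (close call p.1 p.2).andThen fun c => Prog.done (p, c)).andThen fun results =>
  Prog.done (check Δ Θ fun s t => ((s, t), true) ∈ results)

/-- `MatchAction(s, t, a)`. The entry `(Δ, Θ, b)` of the list `results.flatten` records the value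
`b` computed for the transitions to `Δ` and `Θ`. -/
noncomputable def matchAction (s t : S) (a : Act) : Prog S Bool :=
  (Prog.forEach (E.transitions s a) fun Δ =>
    Prog.forEach (E.transitions t a) fun Θ =>
      (matchDistribution E call Δ Θ).andThen fun b =>
        Prog.done (Δ, Θ, b)).andThen fun results =>
  Prog.done (decide
    ((∀ Δ ∈ E.transitions s a, ∃ Θ ∈ E.transitions t a, (Δ, Θ, true) ∈ results.flatten) ∧
     (∀ Θ ∈ E.transitions t a, ∃ Δ ∈ E.transitions s a, (Δ, Θ, true) ∈ results.flatten)))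

/-- The body of `Match(s, t)`, where `call` stands for the recursive calls. -/
noncomputable def matchBody (s t : S) : Prog S Bool := fun σ =>
  ((Prog.forEach (E.actions s t) (matchAction E call s t)).andThen fun bs σ' =>
    if bs.all id = false then
      if (s, t) ∈ σ'.assumed then
        .wrongAssumption { σ' with notBisim := σ'.notBisim ∪ {(s, t)} }
      else
        .ret false { σ' with notBisim := σ'.notBisim ∪ {(s, t)} }
    else
      .ret true σ') { σ with visited := σ.visited ∪ {(s, t)} }

/-- `Match(s, t)` with recursion depth less than `n`. -/
noncomputable def matchStates : ℕ → S → S → Prog S Bool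
  | 0 => fun _ _ _ => .outOfFuel
  | n + 1 => matchBody E (matchStates n)

/-- `Bis(s, t)` with fewer than `n` restarts, including the handler of `WrongAssumption`:
every restart clears `Visited` and `Assumed` and keeps `NotBisim`. -/
noncomputable def bis : ℕ → S → S → Prog S Bool
  | 0 => fun _ _ _ => .outOfFuel
  | n + 1 => fun s t σ =>
    match matchStates E n s t { σ with visited := ∅, assumed := ∅ } with
    | .outOfFuel => .outOfFuel
    | .wrongAssumption σ' => bis n s t σ'
    | .ret b σ' => .ret b σ'

/-- `Bisim(s, t)` terminates and returns `b`, where the loops run in the order `E`. -/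
def BisimReturns (s t : S) (b : Bool) : Prop :=
  ∃ n σ, bis E n s t { notBisim := ∅, visited := ∅, assumed := ∅ } = .ret b σ

end PLTS

/-! The flow test is exact. Flows in the network correspond to matrices supported on `R` with row
sums at most `Δ` and column sums at most `Θ`. Total mass 1 makes all these bounds tight, which gives
a coupling, and a coupling exists exactly when the lifting holds (`check_eq_true_iff`).

The two answers of the algorithm have different status. `Close` overestimates bisimilarity: it
rejects only pairs that are truly not bisimilar. So a failed `Match` refutes bisimilarity
unconditionally, and `NotBisim` stays sound even when an exception is raised. The answer true is
conditional: a finished, unrefuted pair matches up to the pairs that are assumed or themselves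
finished and unrefuted (`Store.Valid`). Refuting an assumption aborts the run. Hence in a run that
returns, all assumptions survive and no call is pending; the related pairs, together with the root
pair, then form a bisimulation if the answer is true (`Store.Valid.bisimilar`).

For termination, nested calls visit new pairs, which bounds the recursion depth, and every restart
strictly enlarges `NotBisim`. `Prog.Spec` carries both facts through the program, and `bis_spec`
combines them. -/

/-! ### Couplings -/

/-- A distribution on pairs with marginals `Δ` and `Θ` that is concentrated on `R`. -/
structure IsCoupling {S : Type u} {T : Type v} (R : S → T → Prop) (Δ : FinDist S) (Θ : FinDist T)
    (W : FinDist (S × T)) : Prop where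
  map_fst : W.map Prod.fst = Δ
  map_snd : W.map Prod.snd = Θ
  rel : ∀ x, W.weights x ≠ 0 → R x.1 x.2

section Coupling

variable {S : Type u} {T : Type v} {R : S → T → Prop} {Δ : FinDist S} {Θ : FinDist T}

theorem StdSimplex.weights_iConvexComb_eq_sum {I : Type v} {X : Type u} (p : StdSimplex ℝ I)
    (f : I → FinDist X) :
    (iConvexComb p f).weights = p.weights.sum fun i r => r • (f i).weights := by
  simp [iConvexComb, Finsupp.sum_mapDomain_index, add_smul]

/-- Taking marginals commutes with convex combinations, so couplings can be mixed with the same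
weights. -/
theorem Lift.exists_isCoupling (h : Lift R Δ Θ) : ∃ W, IsCoupling R Δ Θ W := by
  induction h with
  | @point s t h =>
    refine ⟨.single (s, t), by simp, by simp, fun x hx => ?_⟩
    have : (s, t) = x := by
      by_contra hne
      exact hx (by simp [hne])
    exact this ▸ h
  | comb p Δ Θ _ ih =>
    choose W hW using ih
    refine ⟨iConvexComb p W, ?_, ?_, fun x hx => ?_⟩
    · rw [map_iConvexComb]
      exact congrArg _ (funext fun i => (hW i).map_fst)
    · rw [map_iConvexComb]
      exact congrArg _ (funext fun i => (hW i).map_snd)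
    · rw [StdSimplex.weights_iConvexComb_eq_sum, Finsupp.sum_apply] at hx
      obtain ⟨i, -, hi⟩ := Finset.exists_ne_zero_of_sum_ne_zero hx
      exact (hW i).rel x (right_ne_zero_of_smul hi)

theorem StdSimplex.map_eq_iConvexComb {I : Type*} {X : Type*} {Y : Type*} {p : StdSimplex ℝ I}
    {j : I → X} {W : FinDist X} (h : p.map j = W) (g : X → Y) :
    W.map g = iConvexComb p fun i => StdSimplex.single (g (j i)) := by
  subst h
  ext1
  rw [StdSimplex.weights_iConvexComb_eq_sum, StdSimplex.map_map, StdSimplex.weights_map,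
    Finsupp.mapDomain]
  simp

/-- `W` is a mixture of the point masses on its support, and both marginals inherit the same
weights. The support is enumerated because `Lift.comb` takes weights on `Fin n`. -/
theorem IsCoupling.lift {W : FinDist (S × T)} (h : IsCoupling R Δ Θ W) : Lift R Δ Θ := by
  let e := W.weights.support.equivFin.symm
  let j : Fin W.weights.support.card → S × T := fun i => (e i : S × T)
  have hj : Function.Injective j := Subtype.val_injective.comp e.injective
  have hr : ∀ x ∈ W.weights.support, x ∈ Set.range j := fun x hx =>
    ⟨e.symm ⟨x, hx⟩, by simp [j]⟩
  have hm : (W.weights.comapDomain j hj.injOn).mapDomain j = W.weights :=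
    Finsupp.mapDomain_comapDomain j hj _ hr
  let p : StdSimplex ℝ (Fin W.weights.support.card) :=
    { weights := W.weights.comapDomain j hj.injOn
      nonneg := fun i => by simp
      total := by
        have := W.total
        rw [← hm, Finsupp.sum_mapDomain_index (by simp) (by simp)] at this
        exact this }
  have hp : p.map j = W := by
    ext1
    exact hm
  rw [← h.map_fst, ← h.map_snd, StdSimplex.map_eq_iConvexComb hp Prod.fst,
    StdSimplex.map_eq_iConvexComb hp Prod.snd]
  refine .comb p _ _ fun i => .point (h.rel _ ?_)
  exact Finsupp.mem_support_iff.1 (e i).2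

theorem Lift.symm (h : Lift R Δ Θ) : Lift (fun t s => R s t) Θ Δ := by
  induction h with
  | point h => exact .point h
  | comb p Δ Θ _ ih => exact .comb p Θ Δ ih

theorem StdSimplex.weights_map_ne_zero {X : Type u} {Y : Type v} (W : FinDist X) (g : X → Y)
    {x : X} (hx : W.weights x ≠ 0) : (W.map g).weights (g x) ≠ 0 := by
  refine ne_of_gt (lt_of_lt_of_le ((W.weights_nonneg x).lt_of_ne' hx) ?_)
  rw [StdSimplex.weights_map, Finsupp.mapDomain, Finsupp.sum_apply, Finsupp.sum]
  refine le_trans (by simp) (Finset.single_le_sum (f := fun y =>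
    (Finsupp.single (g y) (W.weights y)) (g x)) (fun y _ => ?_) (Finsupp.mem_support_iff.2 hx))
  rw [Finsupp.single_apply]
  split_ifs <;> simp

/-- Liftings only depend on the relation between the supports. -/
theorem Lift.restrict_support (h : Lift R Δ Θ) :
    Lift (fun s t => R s t ∧ s ∈ Δ.weights.support ∧ t ∈ Θ.weights.support) Δ Θ := by
  obtain ⟨W, hW⟩ := h.exists_isCoupling
  refine IsCoupling.lift ⟨hW.map_fst, hW.map_snd, fun x hx => ⟨hW.rel x hx, ?_, ?_⟩⟩
  · rw [Finsupp.mem_support_iff, ← hW.map_fst]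
    exact StdSimplex.weights_map_ne_zero W _ hx
  · rw [Finsupp.mem_support_iff, ← hW.map_snd]
    exact StdSimplex.weights_map_ne_zero W _ hx

end Coupling

/-! ### Maximum flows and liftings -/

section Flow

variable {S : Type u} [Fintype S]

theorem FlowNode.sum_eq (g : FlowNode S → ℝ) :
    ∑ x, g x = g .source + g .sink + ∑ s, g (.state s) + ∑ s, g (.copy s) := by
  have h : (Finset.univ : Finset (FlowNode S)) =
      {.source, .sink} ∪ Finset.univ.image .state ∪ Finset.univ.image .copy := rfl
  rw [h, Finset.sum_union, Finset.sum_union, Finset.sum_pair (by simp),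
    Finset.sum_image fun _ _ _ _ => FlowNode.state.inj,
    Finset.sum_image fun _ _ _ _ => FlowNode.copy.inj]
  · simp [Finset.disjoint_left]
  · simp only [Finset.disjoint_left, Finset.mem_union, Finset.mem_insert, Finset.mem_singleton,
      Finset.mem_image]
    rintro x ((rfl | rfl) | ⟨s, -, rfl⟩) <;> simp

variable {Δ Θ : FinDist S} {R : S → S → Prop}

theorem mem_edges_liftNetwork {e : FlowNode S × FlowNode S} :
    e ∈ (liftNetwork Δ Θ R).edges ↔ liftEdge R e := by
  simp [liftNetwork]

theorem outflow_liftNetwork (f : FlowNode S × FlowNode S → ℝ) (x : FlowNode S) :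
    (liftNetwork Δ Θ R).outflow f x = ∑ y, if liftEdge R (x, y) then f (x, y) else 0 := by
  rw [Network.outflow, Finset.sum_filter, liftNetwork, Finset.sum_filter, Fintype.sum_prod_type,
    Finset.sum_eq_single x]
  · simp
  · intro y _ hy
    simp [hy]
  · simp

theorem inflow_liftNetwork (f : FlowNode S × FlowNode S → ℝ) (y : FlowNode S) :
    (liftNetwork Δ Θ R).inflow f y = ∑ x, if liftEdge R (x, y) then f (x, y) else 0 := by
  rw [Network.inflow, Finset.sum_filter, liftNetwork, Finset.sum_filter, Fintype.sum_prod_type_right,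
    Finset.sum_eq_single y]
  · simp
  · intro x _ hx
    simp [hx]
  · simp

theorem value_liftNetwork (f : FlowNode S × FlowNode S → ℝ) :
    (liftNetwork Δ Θ R).value f = ∑ s, f (.source, .state s) := by
  rw [Network.value, outflow_liftNetwork, inflow_liftNetwork, FlowNode.sum_eq, FlowNode.sum_eq]
  simp [liftNetwork, liftEdge]

theorem inflow_state (f : FlowNode S × FlowNode S → ℝ) (s : S) :
    (liftNetwork Δ Θ R).inflow f (.state s) = f (.source, .state s) := by
  rw [inflow_liftNetwork, FlowNode.sum_eq]
  simp [liftEdge]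

theorem outflow_state (f : FlowNode S × FlowNode S → ℝ) (s : S) :
    (liftNetwork Δ Θ R).outflow f (.state s) =
      ∑ t, if R s t then f (.state s, .copy t) else 0 := by
  rw [outflow_liftNetwork, FlowNode.sum_eq]
  simp [liftEdge]
  rfl

theorem inflow_copy (f : FlowNode S × FlowNode S → ℝ) (t : S) :
    (liftNetwork Δ Θ R).inflow f (.copy t) =
      ∑ s, if R s t then f (.state s, .copy t) else 0 := by
  rw [inflow_liftNetwork, FlowNode.sum_eq]
  simp [liftEdge]
  rfl

theorem outflow_copy (f : FlowNode S × FlowNode S → ℝ) (t : S) :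
    (liftNetwork Δ Θ R).outflow f (.copy t) = f (.copy t, .sink) := by
  rw [outflow_liftNetwork, FlowNode.sum_eq]
  simp [liftEdge]

/-- Matrices supported on `R` whose row and column sums are bounded by `Δ` and `Θ`. -/
def subcouplings (Δ Θ : FinDist S) (R : S → S → Prop) : Set (S → S → ℝ) :=
  {w | (∀ s t, 0 ≤ w s t) ∧ (∀ s t, ¬ R s t → w s t = 0) ∧
    (∀ s, ∑ t, w s t ≤ Δ.weights s) ∧ ∀ t, ∑ s, w s t ≤ Θ.weights t}

theorem StdSimplex.sum_weights (Δ : FinDist S) : ∑ s, Δ.weights s = 1 := by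
  rw [← Δ.total, Finsupp.sum_fintype _ _ (by simp)]

theorem StdSimplex.weights_le_one (Δ : FinDist S) (s : S) : Δ.weights s ≤ 1 := by
  rw [← StdSimplex.sum_weights Δ]
  exact Finset.single_le_sum (f := fun s => Δ.weights s) (fun i _ => Δ.weights_nonneg i)
    (Finset.mem_univ s)

theorem le_of_mem_subcouplings {w : S → S → ℝ} (hw : w ∈ subcouplings Δ Θ R) (s t : S) :
    w s t ≤ Δ.weights s :=
  (Finset.single_le_sum (f := fun t => w s t) (fun t _ => hw.1 s t) (Finset.mem_univ t)).trans
    (hw.2.2.1 s)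

/-- By conservation, the source and sink edges carry the row and column sums of the flow on the
middle edges, so that matrix determines the flow. -/
theorem setOf_value_liftNetwork (Δ Θ : FinDist S) (R : S → S → Prop) :
    {x | ∃ f, (liftNetwork Δ Θ R).IsFlow f ∧ x = (liftNetwork Δ Θ R).value f} =
      (fun w : S → S → ℝ => ∑ s, ∑ t, w s t) '' subcouplings Δ Θ R := by
  ext x
  constructor
  · rintro ⟨f, hf, rfl⟩
    have hs : ∀ s, ∑ t, (if R s t then f (.state s, .copy t) else 0) = f (.source, .state s) := by
      intro s
      rw [← outflow_state (Δ := Δ) (Θ := Θ), ← hf.conserved _ (by simp [liftNetwork])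
        (by simp [liftNetwork]), inflow_state]
    have ht : ∀ t, ∑ s, (if R s t then f (.state s, .copy t) else 0) = f (.copy t, .sink) := by
      intro t
      rw [← inflow_copy (Δ := Δ) (Θ := Θ), hf.conserved _ (by simp [liftNetwork])
        (by simp [liftNetwork]), outflow_copy]
    -- A flow function is arbitrary off the edges, so it is cut down to `R`.
    refine ⟨fun s t => if R s t then f (.state s, .copy t) else 0, ⟨fun s t => ?_, ?_, ?_, ?_⟩, ?_⟩
    · beta_reduce
      split_ifs with h
      · exact hf.nonneg _ (mem_edges_liftNetwork.2 h)
      · exact le_rfl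
    · intro s t h
      simp [h]
    · intro s
      rw [hs]
      exact hf.le_cap _ (mem_edges_liftNetwork.2 trivial)
    · intro t
      rw [ht]
      exact hf.le_cap _ (mem_edges_liftNetwork.2 trivial)
    · rw [value_liftNetwork]
      exact Finset.sum_congr rfl fun s _ => hs s
  · rintro ⟨w, hw, rfl⟩
    let f : FlowNode S × FlowNode S → ℝ
      | (.state s, .copy t) => w s t
      | (.source, .state s) => ∑ t, w s t
      | (.copy t, .sink) => ∑ s, w s t
      | _ => 0
    have hR : ∀ s t, (if R s t then w s t else 0) = w s t := fun s t => by
      split_ifs with h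
      · rfl
      · exact (hw.2.1 s t h).symm
    refine ⟨f, ⟨?_, ?_, ?_⟩, ?_⟩
    · rintro ⟨x, y⟩ -
      cases x <;> cases y <;>
        first
        | exact le_rfl
        | exact hw.1 _ _
        | exact Finset.sum_nonneg fun _ _ => hw.1 _ _
    · rintro ⟨x, y⟩ he
      rw [mem_edges_liftNetwork] at he
      cases x <;> cases y <;>
        first
        | exact he.elim
        | exact hw.2.2.1 _
        | exact hw.2.2.2 _
        -- The capacity 1 of a middle edge never binds.
        | exact (le_of_mem_subcouplings hw _ _).trans (StdSimplex.weights_le_one Δ _)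
    · intro x h₁ h₂
      cases x with
      | source => exact absurd rfl h₁
      | sink => exact absurd rfl h₂
      | state s =>
        rw [inflow_state, outflow_state]
        exact Finset.sum_congr rfl fun t _ => (hR s t).symm
      | copy t =>
        rw [inflow_copy, outflow_copy]
        exact Finset.sum_congr rfl fun s _ => hR s t
    · rw [value_liftNetwork]

theorem isCompact_subcouplings (Δ Θ : FinDist S) (R : S → S → Prop) :
    IsCompact (subcouplings Δ Θ R) := by
  refine (isCompact_Icc (a := (0 : S → S → ℝ)) (b := fun s _ => Δ.weights s)).of_isClosed_subset
    ?_ fun w hw => ⟨fun s t => hw.1 s t, fun s t => le_of_mem_subcouplings hw s t⟩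
  simp only [subcouplings, Set.ofPred_and, Set.ofPred_forall]
  refine .inter (isClosed_iInter fun s => isClosed_iInter fun t => ?_)
    (.inter (isClosed_iInter fun s => isClosed_iInter fun t => isClosed_iInter fun _ => ?_)
    (.inter (isClosed_iInter fun s => ?_) (isClosed_iInter fun t => ?_)))
  · exact isClosed_le (by fun_prop) (by fun_prop)
  · exact isClosed_eq (by fun_prop) (by fun_prop)
  · exact isClosed_le (by fun_prop) (by fun_prop)
  · exact isClosed_le (by fun_prop) (by fun_prop)

/-- By compactness the supremum in `maxFlow` is attained. -/
theorem check_eq_true_iff_exists_subcoupling :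
    check Δ Θ R = true ↔ ∃ w ∈ subcouplings Δ Θ R, 1 ≤ ∑ s, ∑ t, w s t := by
  have hc : IsCompact ((fun w : S → S → ℝ => ∑ s, ∑ t, w s t) '' subcouplings Δ Θ R) :=
    (isCompact_subcouplings Δ Θ R).image (by fun_prop)
  have hn : (subcouplings Δ Θ R).Nonempty := ⟨0, by simp [subcouplings]⟩
  have hm : (liftNetwork Δ Θ R).maxFlow =
      sSup ((fun w : S → S → ℝ => ∑ s, ∑ t, w s t) '' subcouplings Δ Θ R) := by
    rw [Network.maxFlow, setOf_value_liftNetwork]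
  have : check Δ Θ R = true ↔ 1 ≤ (liftNetwork Δ Θ R).maxFlow := by
    simp [check]
  rw [this, hm]
  constructor
  · intro h
    obtain ⟨w, hw, he⟩ := hc.sSup_mem (hn.image _)
    exact ⟨w, hw, h.trans_eq he.symm⟩
  · rintro ⟨w, hw, h⟩
    exact h.trans (le_csSup hc.bddAbove ⟨w, hw, rfl⟩)

theorem StdSimplex.weights_map_fst (W : FinDist (S × S)) (s : S) :
    (W.map Prod.fst).weights s = ∑ t, W.weights (s, t) := by
  rw [StdSimplex.weights_map, Finsupp.mapDomain, Finsupp.sum_apply,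
    Finsupp.sum_fintype _ _ (by simp), Fintype.sum_prod_type, Finset.sum_eq_single s]
  · simp
  · intro x _ hx
    simp [hx]
  · simp

theorem StdSimplex.weights_map_snd (W : FinDist (S × S)) (t : S) :
    (W.map Prod.snd).weights t = ∑ s, W.weights (s, t) := by
  rw [StdSimplex.weights_map, Finsupp.mapDomain, Finsupp.sum_apply,
    Finsupp.sum_fintype _ _ (by simp), Fintype.sum_prod_type_right, Finset.sum_eq_single t]
  · simp
  · intro x _ hx
    simp [hx]
  · simp

/-- The maximum flow test decides the lifting of relations. -/
theorem check_eq_true_iff : check Δ Θ R = true ↔ Lift R Δ Θ := by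
  rw [check_eq_true_iff_exists_subcoupling]
  constructor
  · rintro ⟨w, ⟨h₀, hR, hΔ, hΘ⟩, h₁⟩
    have hle : ∑ s, ∑ t, w s t ≤ 1 :=
      (Finset.sum_le_sum fun s _ => hΔ s).trans_eq (StdSimplex.sum_weights Δ)
    have hsum : ∑ s, ∑ t, w s t = 1 := le_antisymm hle h₁
    -- Equal totals and termwise bounds force equality in every row, and likewise in every column.
    have hrow : ∀ s, ∑ t, w s t = Δ.weights s := fun s =>
      (Finset.sum_eq_sum_iff_of_le fun s _ => hΔ s).1
        (hsum.trans (StdSimplex.sum_weights Δ).symm) s (Finset.mem_univ s)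
    have hcol : ∀ t, ∑ s, w s t = Θ.weights t := fun t =>
      (Finset.sum_eq_sum_iff_of_le fun t _ => hΘ t).1
        ((Finset.sum_comm.trans hsum).trans (StdSimplex.sum_weights Θ).symm) t (Finset.mem_univ t)
    let W : FinDist (S × S) :=
      { weights := Finsupp.equivFunOnFinite.symm fun x => w x.1 x.2
        nonneg := fun x => h₀ x.1 x.2
        total := by
          rw [Finsupp.sum_fintype _ _ (by simp), Fintype.sum_prod_type]
          exact hsum }
    refine IsCoupling.lift (W := W) ⟨?_, ?_, fun x hx => ?_⟩
    · ext s
      rw [StdSimplex.weights_map_fst]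
      exact hrow s
    · ext t
      rw [StdSimplex.weights_map_snd]
      exact hcol t
    · by_contra h
      exact hx (hR _ _ h)
  · intro h
    obtain ⟨W, hW⟩ := h.exists_isCoupling
    refine ⟨fun s t => W.weights (s, t), ⟨fun s t => W.weights_nonneg _, fun s t hn => ?_,
      fun s => ?_, fun t => ?_⟩, ?_⟩
    · by_contra h
      exact hn (hW.rel _ h)
    · rw [← hW.map_fst, StdSimplex.weights_map_fst]
    · rw [← hW.map_snd, StdSimplex.weights_map_snd]
    · rw [← Fintype.sum_prod_type, StdSimplex.sum_weights]

end Flow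

/-! ### Invariants of the store -/

namespace PLTS

variable {S : Type u} {Act : Type v}

/-- The transitions of `s` and `t` with label `a` match each other up to `Q`. -/
def MatchesAction (L : PLTS S Act) (Q : S → S → Prop) (s t : S) (a : Act) : Prop :=
  (∀ Δ, L.Trans s a Δ → ∃ Θ, L.Trans t a Θ ∧ Lift Q Δ Θ) ∧
    ∀ Θ, L.Trans t a Θ → ∃ Δ, L.Trans s a Δ ∧ Lift Q Δ Θ

variable {L : PLTS S Act} {Q Q' : S → S → Prop} {s t : S} {a : Act}

theorem MatchesAction.mono (h : ∀ s t, Q s t → Q' s t) (hm : L.MatchesAction Q s t a) :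
    L.MatchesAction Q' s t a :=
  ⟨fun Δ hΔ => let ⟨Θ, hΘ, hl⟩ := hm.1 Δ hΔ; ⟨Θ, hΘ, hl.mono h⟩,
    fun Θ hΘ => let ⟨Δ, hΔ, hl⟩ := hm.2 Θ hΘ; ⟨Δ, hΔ, hl.mono h⟩⟩

theorem isBisimulation_iff : L.IsBisimulation Q ↔ ∀ s t, Q s t → ∀ a, L.MatchesAction Q s t a := by
  constructor
  · intro h s t hQ a
    exact ⟨h.1 s t hQ a, fun Θ hΘ => let ⟨Δ, hΔ, hl⟩ := h.2 t s hQ a Θ hΘ; ⟨Δ, hΔ, hl.symm⟩⟩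
  · intro h
    exact ⟨fun s t hQ a => (h s t hQ a).1, fun t s hQ a Θ hΘ =>
      let ⟨Δ, hΔ, hl⟩ := (h s t hQ a).2 Θ hΘ; ⟨Δ, hΔ, hl.symm⟩⟩

theorem Bisimilar.matchesAction (h : L.Bisimilar s t) (a : Act) :
    L.MatchesAction L.Bisimilar s t a :=
  isBisimulation_iff.1 L.isGreatest_bisimilar.1 s t h a

end PLTS

namespace Store

variable {S : Type u} {Act : Type v}

/-- The pairs that are assumed, or have been matched successfully; the calls of `Match` for the
pairs in `P` are still running. -/
def Related (P : Set (S × S)) (σ : Store S) (s t : S) : Prop :=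
  (s, t) ∈ σ.assumed ∨ ((s, t) ∈ σ.visited ∧ (s, t) ∉ σ.notBisim ∧ (s, t) ∉ P)

/-- All pairs that are declared not bisimilar are indeed not bisimilar. -/
def Sound (L : PLTS S Act) (σ : Store S) : Prop :=
  ∀ s t, (s, t) ∈ σ.notBisim → ¬ L.Bisimilar s t

/-- The invariant of a run of `Bis`; the calls of `Match` for the pairs in `P` are still running. -/
structure Valid (L : PLTS S Act) (P : Set (S × S)) (σ : Store S) : Prop where
  sound : σ.Sound L
  notMem_notBisim : ∀ x ∈ σ.assumed, x ∉ σ.notBisim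
  mem_visited : ∀ x ∈ σ.assumed, x ∈ σ.visited
  pending : P ⊆ σ.visited
  matchesAction : ∀ s t, (s, t) ∈ σ.visited → (s, t) ∉ σ.notBisim → (s, t) ∉ P →
    ∀ a, L.MatchesAction (σ.Related P) s t a

/-- How the store may change within one run of `Bis`. -/
structure Extends (σ σ' : Store S) : Prop where
  notBisim : σ.notBisim ⊆ σ'.notBisim
  visited : σ.visited ⊆ σ'.visited
  assumed : σ.assumed ⊆ σ'.assumed
  mem_notBisim : ∀ x ∈ σ'.notBisim, x ∈ σ.visited → x ∈ σ.notBisim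

variable {L : PLTS S Act} {P : Set (S × S)} {σ σ' σ'' : Store S}

theorem Extends.refl (σ : Store S) : σ.Extends σ :=
  ⟨subset_rfl, subset_rfl, subset_rfl, fun _ h _ => h⟩

theorem Extends.trans (h : σ.Extends σ') (h' : σ'.Extends σ'') : σ.Extends σ'' :=
  ⟨h.notBisim.trans h'.notBisim, h.visited.trans h'.visited, h.assumed.trans h'.assumed,
    fun x hx hv => h.mem_notBisim x (h'.mem_notBisim x hx (h.visited hv)) hv⟩

/-- A finished pair stays related because it is already visited, and no visited pair newly enters
`notBisim`. This makes positive answers persist. -/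
theorem Extends.related (h : σ.Extends σ') {s t : S} (hr : σ.Related P s t) : σ'.Related P s t :=
  hr.imp (fun ha => h.assumed ha) fun ⟨hv, hn, hP⟩ =>
    ⟨h.visited hv, fun hn' => hn (h.mem_notBisim _ hn' hv), hP⟩

end Store

/-! ### Hoare triples for programs -/

namespace Prog

universe w

variable {S : Type u} {Act : Type v} {α β : Type*}

/-- Correctness of the run of `p` on `σ`, with recursion depth less than `n`. The run can only hit
the recursion bound if the bound is at most the number of pairs that are not yet visited. -/
def Spec (L : PLTS S Act) (n : ℕ) (P : Set (S × S)) (p : Prog S α) (σ : Store S)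
    (Post : α → Store S → Prop) : Prop :=
  match p σ with
  | .outOfFuel => n ≤ σ.visitedᶜ.ncard
  | .wrongAssumption σ' => σ.notBisim ⊂ σ'.notBisim ∧ σ'.Sound L
  | .ret x σ' => σ'.Valid L P ∧ σ.Extends σ' ∧ Post x σ'

variable {L : PLTS S Act} {n : ℕ} {P : Set (S × S)} {σ : Store S}

theorem spec_done {x : α} {Post : α → Store S → Prop} (hσ : σ.Valid L P) (h : Post x σ) :
    Spec L n P (done x) σ Post :=
  ⟨hσ, .refl σ, h⟩

theorem Spec.andThen [Finite S] {p : Prog S α} {q : α → Prog S β} {Post : α → Store S → Prop}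
    {Post' : β → Store S → Prop} (hp : Spec L n P p σ Post)
    (hq : ∀ x σ', σ'.Valid L P → σ.Extends σ' → Post x σ' → Spec L n P (q x) σ' Post') :
    Spec L n P (p.andThen q) σ Post' := by
  unfold Spec Prog.andThen at *
  cases h : p σ with
  | outOfFuel => simpa [h] using hp
  | wrongAssumption σ' => simpa [h] using hp
  | ret x σ' =>
    simp only [h] at hp ⊢
    have := hq x σ' hp.1 hp.2.1 hp.2.2
    have he := hp.2.1
    cases h' : q x σ' with
    | outOfFuel =>
      simp only [h'] at this ⊢
      exact this.trans (Set.ncard_le_ncard (Set.compl_subset_compl.2 he.visited) (Set.toFinite _))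
    | wrongAssumption σ'' =>
      simp only [h'] at this ⊢
      exact ⟨he.notBisim.trans_ssubset this.1, this.2⟩
    | ret y σ'' =>
      simp only [h'] at this ⊢
      exact ⟨this.1, he.trans this.2.1, this.2.2⟩

/-- Early answers are established for earlier stores; `hPost` transports them to the final one. -/
theorem spec_forEach [Finite S] {body : α → Prog S β} {Post : α → β → Store S → Prop}
    (hPost : ∀ x y σ σ', σ.Extends σ' → Post x y σ → Post x y σ') (l : List α)
    (h : ∀ x ∈ l, ∀ σ, σ.Valid L P → Spec L n P (body x) σ (Post x)) (σ : Store S)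
    (hσ : σ.Valid L P) :
    Spec L n P (forEach l body) σ fun ys σ' => List.Forall₂ (fun x y => Post x y σ') l ys := by
  induction l generalizing σ with
  | nil => exact spec_done hσ .nil
  | cons x l ih =>
    refine (h x (by simp) σ hσ).andThen fun y σ₁ hσ₁ _ hy => ?_
    refine (ih (fun x hx => h x (by simp [hx])) σ₁ hσ₁).andThen fun ys σ₂ hσ₂ h₁₂ hys => ?_
    exact spec_done hσ₂ (.cons (hPost _ _ _ _ h₁₂ hy) hys)

end Prog

namespace List

variable {α β : Type*} {r : α → β → Prop} {l : List α} {l' : List β}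

theorem Forall₂.exists_of_mem_left (h : Forall₂ r l l') {x : α} (hx : x ∈ l) :
    ∃ y ∈ l', r x y := by
  induction h with
  | nil => simp at hx
  | cons h _ ih =>
    rcases List.mem_cons.1 hx with rfl | hx
    · exact ⟨_, by simp, h⟩
    · obtain ⟨y, hy, hr⟩ := ih hx
      exact ⟨y, by simp [hy], hr⟩

theorem Forall₂.exists_of_mem_right (h : Forall₂ r l l') {y : β} (hy : y ∈ l') :
    ∃ x ∈ l, r x y :=
  h.flip.exists_of_mem_left hy

end List

/-! ### Correctness of the algorithm -/

namespace PLTS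

open Prog

variable {S : Type u} {Act : Type v} {L : PLTS S Act} {E : L.Enumeration} {n : ℕ}
  {P : Set (S × S)} {call : S → S → Prog S Bool}

/-- The assertion that `b` is a correct answer to a call of `Match` for a pair that is not yet
declared not bisimilar. -/
def PairPost (L : PLTS S Act) (P : Set (S × S)) (s t : S) (b : Bool) (σ : Store S) : Prop :=
  (b = true → σ.Related P s t) ∧ (b = false → ¬ L.Bisimilar s t)

/-- The assertion that recursive calls of `Match` are correct. -/
def CallSpec (L : PLTS S Act) (n : ℕ) (P : Set (S × S)) (call : S → S → Prog S Bool) : Prop :=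
  ∀ s t σ, σ.Valid L P → (s, t) ∉ σ.visited → (s, t) ∉ σ.notBisim →
    Spec L n P (call s t) σ (PairPost L P s t)

theorem PairPost.mono {s t : S} {b : Bool} {σ σ' : Store S} (h : σ.Extends σ')
    (hp : PairPost L P s t b σ) : PairPost L P s t b σ' :=
  ⟨fun hb => h.related (hp.1 hb), hp.2⟩

/-- In the visited case the pair becomes related by being assumed. The preceding test of `notBisim`
keeps assumptions unrefuted. -/
theorem spec_close (hcall : CallSpec L n P call) (s t : S) (σ : Store S) (hσ : σ.Valid L P) :
    Spec L n P (close call s t) σ (PairPost L P s t) := by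
  by_cases hn : (s, t) ∈ σ.notBisim
  · simp only [Spec, close, hn, if_true]
    exact ⟨hσ, .refl σ, by simp, fun _ => hσ.sound s t hn⟩
  by_cases hv : (s, t) ∈ σ.visited
  · simp only [Spec, close, hn, hv, if_true, if_false]
    have hE : σ.Extends { σ with assumed := σ.assumed ∪ {(s, t)} } :=
      ⟨subset_rfl, subset_rfl, Set.subset_union_left, fun _ h _ => h⟩
    refine ⟨⟨hσ.sound, ?_, ?_, hσ.pending, fun s' t' h₁ h₂ h₃ a =>
      (hσ.matchesAction s' t' h₁ h₂ h₃ a).mono fun _ _ => hE.related⟩, hE,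
      fun _ => Or.inl (by simp), by simp⟩
    · rintro x (hx | rfl)
      · exact hσ.notMem_notBisim x hx
      · exact hn
    · rintro x (hx | rfl)
      · exact hσ.mem_visited x hx
      · exact hv
  · simpa only [Spec, close, hn, hv, if_false] using hcall s t σ hσ hv hn

/-- The assertion that `b` is a correct answer to a call of `MatchDistribution`. -/
def DistributionPost (L : PLTS S Act) (P : Set (S × S)) (Δ Θ : FinDist S) (b : Bool)
    (σ : Store S) : Prop :=
  (b = true → Lift (σ.Related P) Δ Θ) ∧ (b = false → ¬ Lift L.Bisimilar Δ Θ)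

theorem DistributionPost.mono {Δ Θ : FinDist S} {b : Bool} {σ σ' : Store S} (h : σ.Extends σ')
    (hp : DistributionPost L P Δ Θ b σ) : DistributionPost L P Δ Θ b σ' :=
  ⟨fun hb => (hp.1 hb).mono fun _ _ => h.related, hp.2⟩

theorem spec_matchDistribution [Fintype S] (hcall : CallSpec L n P call) (Δ Θ : FinDist S) (σ : Store S)
    (hσ : σ.Valid L P) :
    Spec L n P (matchDistribution E call Δ Θ) σ (DistributionPost L P Δ Θ) := by
  refine (spec_forEach (Post := fun p (y : (S × S) × Bool) σ => y.1 = p ∧ PairPost L P p.1 p.2 y.2 σ)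
    (fun _ _ _ _ h hp => ⟨hp.1, hp.2.mono h⟩) _ (fun p _ σ hσ => ?_) σ hσ).andThen
    fun ys σ' hσ' _ hys => spec_done hσ' ⟨fun hb => ?_, fun hb hl => ?_⟩
  · exact (spec_close hcall p.1 p.2 σ hσ).andThen fun c σ' hσ' _ hc => spec_done hσ' ⟨rfl, hc⟩
  · refine (check_eq_true_iff.1 hb).mono fun s t hst => ?_
    obtain ⟨_, -, rfl, hp⟩ := hys.exists_of_mem_right hst
    exact hp.1 rfl
  -- The accepted pairs include all bisimilar pairs in the supports, and only those matter for the
  -- lifting.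
  · rw [← Bool.not_eq_true, check_eq_true_iff] at hb
    refine hb (hl.restrict_support.mono fun s t ⟨hst, hs, ht⟩ => ?_)
    obtain ⟨⟨_, c⟩, hy, rfl, hp⟩ := hys.exists_of_mem_left ((E.mem_pairs Δ Θ s t).2 ⟨hs, ht⟩)
    cases c with
    | true => exact hy
    | false => exact absurd hst (hp.2 rfl)

/-- The assertion that `b` is a correct answer to a call of `MatchAction`. -/
def ActionPost (L : PLTS S Act) (P : Set (S × S)) (s t : S) (a : Act) (b : Bool)
    (σ : Store S) : Prop :=
  (b = true → L.MatchesAction (σ.Related P) s t a) ∧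
    (b = false → ¬ L.MatchesAction L.Bisimilar s t a)

theorem ActionPost.mono {s t : S} {a : Act} {b : Bool} {σ σ' : Store S} (h : σ.Extends σ')
    (hp : ActionPost L P s t a b σ) : ActionPost L P s t a b σ' :=
  ⟨fun hb => (hp.1 hb).mono fun _ _ => h.related, hp.2⟩

theorem spec_matchAction [Fintype S] (hcall : CallSpec L n P call) (s t : S) (a : Act) (σ : Store S)
    (hσ : σ.Valid L P) :
    Spec L n P (matchAction E call s t a) σ (ActionPost L P s t a) := by
  refine (spec_forEach (Post := fun Δ ys σ => List.Forall₂
      (fun Θ (y : FinDist S × FinDist S × Bool) => y.1 = Δ ∧ y.2.1 = Θ ∧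
        DistributionPost L P Δ Θ y.2.2 σ) (E.transitions t a) ys)
    (fun _ _ _ _ h hp => hp.imp fun _ _ hp => ⟨hp.1, hp.2.1, hp.2.2.mono h⟩) _
    (fun Δ _ σ hσ => ?_) σ hσ).andThen fun yss σ' hσ' _ hyss => spec_done hσ' ?_
  · refine spec_forEach (Post := fun Θ (y : FinDist S × FinDist S × Bool) σ => y.1 = Δ ∧ y.2.1 = Θ ∧
        DistributionPost L P Δ Θ y.2.2 σ)
      (fun _ _ _ _ h hp => ⟨hp.1, hp.2.1, hp.2.2.mono h⟩) _ (fun Θ _ σ hσ => ?_) σ hσ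
    exact (spec_matchDistribution hcall Δ Θ σ hσ).andThen fun b σ' hσ' _ hb =>
      spec_done hσ' ⟨rfl, rfl, hb⟩
  have hlift : ∀ {Δ Θ}, (Δ, Θ, true) ∈ yss.flatten → Lift (σ'.Related P) Δ Θ := by
    intro Δ Θ h
    obtain ⟨ys, hys, hy⟩ := List.mem_flatten.1 h
    obtain ⟨_, -, hys'⟩ := hyss.exists_of_mem_right hys
    obtain ⟨_, -, rfl, rfl, hp⟩ := hys'.exists_of_mem_right hy
    exact hp.1 rfl
  have hmem : ∀ {Δ Θ}, L.Trans s a Δ → L.Trans t a Θ → Lift L.Bisimilar Δ Θ →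
      (Δ, Θ, true) ∈ yss.flatten := by
    intro Δ Θ hΔ hΘ hl
    obtain ⟨ys, hys, hys'⟩ := hyss.exists_of_mem_left ((E.mem_transitions s a Δ).2 hΔ)
    obtain ⟨⟨_, _, b⟩, hy, rfl, rfl, hp⟩ :=
      hys'.exists_of_mem_left ((E.mem_transitions t a Θ).2 hΘ)
    cases b with
    | true => exact List.mem_flatten.2 ⟨ys, hys, hy⟩
    | false => exact absurd hl (hp.2 rfl)
  simp only [ActionPost, decide_eq_true_eq, decide_eq_false_iff_not, E.mem_transitions]
  refine ⟨fun ⟨h₁, h₂⟩ => ⟨fun Δ hΔ => ?_, fun Θ hΘ => ?_⟩, fun h hm => h ⟨fun Δ hΔ => ?_,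
    fun Θ hΘ => ?_⟩⟩
  · obtain ⟨Θ, hΘ, h⟩ := h₁ Δ hΔ
    exact ⟨Θ, hΘ, hlift h⟩
  · obtain ⟨Δ, hΔ, h⟩ := h₂ Θ hΘ
    exact ⟨Δ, hΔ, hlift h⟩
  · obtain ⟨Θ, hΘ, h⟩ := hm.1 Δ hΔ
    exact ⟨Θ, hΘ, hmem hΔ hΘ h⟩
  · obtain ⟨Δ, hΔ, h⟩ := hm.2 Θ hΘ
    exact ⟨Δ, hΔ, hmem hΔ hΘ h⟩

/-- The new pair is pending as soon as it is visited, so it brings no matching obligation. Being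
new, it is not among the finished pairs, so none of them stops being related. -/
theorem _root_.Store.Valid.insert_visited {σ : Store S} {s t : S} (hσ : σ.Valid L P)
    (hv : (s, t) ∉ σ.visited) :
    Store.Valid L (P ∪ {(s, t)}) { σ with visited := σ.visited ∪ {(s, t)} } := by
  refine ⟨hσ.sound, hσ.notMem_notBisim, fun x hx => Or.inl (hσ.mem_visited x hx),
    Set.union_subset_union_left _ hσ.pending, ?_⟩
  rintro s' t' (h₁ | h₁) h₂ h₃ a
  · refine (hσ.matchesAction s' t' h₁ h₂ (fun h => h₃ (Or.inl h)) a).mono ?_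
    rintro u w (h | ⟨hu, hn, hP⟩)
    · exact Or.inl h
    · refine Or.inr ⟨Or.inl hu, hn, ?_⟩
      rintro (h | h)
      · exact hP h
      · exact hv (h ▸ hu)
  · exact absurd (Or.inr h₁) h₃

/-- Matching and relatedness are separate conclusions because the root call bypasses `Close`: after
a restart its pair may already lie in `notBisim`. -/
theorem spec_matchBody [Fintype S] {s t : S} {σ : Store S}
    (hcall : CallSpec L n (P ∪ {(s, t)}) call) (hσ : σ.Valid L P) (hv : (s, t) ∉ σ.visited) :
    Spec L (n + 1) P (matchBody E call s t) σ fun b σ' =>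
      (b = true → ∀ a, L.MatchesAction (σ'.Related P) s t a) ∧
      (b = false → ¬ L.Bisimilar s t) ∧
      ((s, t) ∉ σ.notBisim → b = true → σ'.Related P s t) := by
  have hσ₀ := hσ.insert_visited hv
  have hrun := spec_forEach (Post := ActionPost L (P ∪ {(s, t)}) s t)
    (fun _ _ _ _ h hp => hp.mono h) (E.actions s t)
    (fun a _ σ hσ => spec_matchAction (E := E) hcall s t a σ hσ) _ hσ₀
  have hE₀ : σ.Extends { σ with visited := σ.visited ∪ {(s, t)} } :=
    ⟨subset_rfl, Set.subset_union_left, subset_rfl, fun _ h _ => h⟩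
  unfold Spec matchBody Prog.andThen at *
  cases h : forEach (E.actions s t) (matchAction E call s t)
      { σ with visited := σ.visited ∪ {(s, t)} } with
  | outOfFuel =>
    simp only [h] at hrun ⊢
    -- The pair has just left the unvisited set, which pays for one level of recursion.
    refine Nat.succ_le_of_lt (hrun.trans_lt (Set.ncard_lt_ncard ?_ (Set.toFinite _)))
    exact Set.ssubset_iff_exists.2 ⟨Set.compl_subset_compl.2 Set.subset_union_left, (s, t), hv,
      fun h => h (Or.inr rfl)⟩
  | wrongAssumption σ' => simpa only [h] using hrun
  | ret bs σ₁ =>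
    simp only [h] at hrun ⊢
    obtain ⟨hσ₁, hE, hbs⟩ := hrun
    have hv₁ : (s, t) ∈ σ₁.visited := hE.visited (Or.inr rfl)
    by_cases hb : bs.all id = false
    · have hbis : ¬ L.Bisimilar s t := by
        simp only [List.all_eq_false, id, Bool.not_eq_true] at hb
        obtain ⟨b, hb, hf⟩ := hb
        obtain ⟨a, -, ha⟩ := hbs.exists_of_mem_right hb
        exact fun hst => ha.2 hf (hst.matchesAction a)
      have hsound : Store.Sound L { σ₁ with notBisim := σ₁.notBisim ∪ {(s, t)} } := by
        rintro s' t' (hn | hn)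
        · exact hσ₁.sound s' t' hn
        · cases hn
          exact hbis
      by_cases ha : (s, t) ∈ σ₁.assumed
      · simp only [hb, ha, if_true]
        -- The inclusion is strict because an assumed pair was not in `notBisim` before.
        refine ⟨Set.ssubset_iff_exists.2 ⟨hE.notBisim.trans Set.subset_union_left, (s, t),
          Or.inr rfl, fun hn => hσ₁.notMem_notBisim _ ha (hE.notBisim hn)⟩, hsound⟩
      · simp only [hb, ha, if_true, if_false]
        refine ⟨⟨hsound, ?_, hσ₁.mem_visited,
          Set.subset_union_left.trans hσ₁.pending, ?_⟩, ⟨hE.notBisim.trans Set.subset_union_left,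
          hE₀.visited.trans hE.visited, hE.assumed, ?_⟩, by simp, fun _ => hbis, by simp⟩
        · rintro x hx (hn | rfl)
          · exact hσ₁.notMem_notBisim x hx hn
          · exact ha hx
        · intro s' t' h₁ h₂ h₃ a
          refine (hσ₁.matchesAction s' t' h₁ (fun hn => h₂ (Or.inl hn)) ?_ a).mono ?_
          · rintro (hP | hP)
            · exact h₃ hP
            · exact h₂ (Or.inr hP)
          -- The refuted pair was pending and not assumed, hence not related: no matching relied on
          -- it.
          · rintro u w (h | ⟨hu, hn, hP⟩)
            · exact Or.inl h
            · refine Or.inr ⟨hu, ?_, fun h => hP (Or.inl h)⟩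
              rintro (h | h)
              · exact hn h
              · exact hP (Or.inr h)
        · rintro x (hn | rfl) hx
          · exact hE.mem_notBisim x hn (Or.inl hx)
          · exact absurd hx hv
    · simp only [hb]
      -- With fewer pending pairs, more pairs are related.
      have hrel : ∀ u w, σ₁.Related (P ∪ {(s, t)}) u w → σ₁.Related P u w := by
        rintro u w (h | ⟨hu, hn, hP⟩)
        · exact Or.inl h
        · exact Or.inr ⟨hu, hn, fun h => hP (Or.inl h)⟩
      have hm : ∀ a, L.MatchesAction (σ₁.Related P) s t a := by
        intro a
        by_cases ha : a ∈ E.actions s t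
        · obtain ⟨b, hb', hp⟩ := hbs.exists_of_mem_left ha
          simp only [Bool.not_eq_false, List.all_eq_true, id] at hb
          exact (hp.1 (hb b hb')).mono hrel
        · exact ⟨fun Δ hΔ => absurd (E.mem_actions s t a Δ (Or.inl hΔ)) ha,
            fun Θ hΘ => absurd (E.mem_actions s t a Θ (Or.inr hΘ)) ha⟩
      refine ⟨⟨hσ₁.sound, hσ₁.notMem_notBisim, hσ₁.mem_visited,
        Set.subset_union_left.trans hσ₁.pending, ?_⟩, hE₀.trans hE, fun _ => hm, by simp,
        fun hn _ => Or.inr ⟨hv₁, fun hn' => hn (hE.mem_notBisim _ hn' (Or.inr rfl)),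
          fun hP => hv (hσ.pending hP)⟩⟩
      · intro s' t' h₁ h₂ h₃ a
        by_cases hst : (s', t') = (s, t)
        · cases hst
          exact hm a
        · refine (hσ₁.matchesAction s' t' h₁ h₂ ?_ a).mono hrel
          rintro (hP | hP)
          · exact h₃ hP
          · exact hst hP

theorem spec_matchStates [Fintype S] (n : ℕ) {P : Set (S × S)} {s t : S} {σ : Store S}
    (hσ : σ.Valid L P) (hv : (s, t) ∉ σ.visited) :
    Spec L n P (matchStates E n s t) σ fun b σ' =>
      (b = true → ∀ a, L.MatchesAction (σ'.Related P) s t a) ∧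
      (b = false → ¬ L.Bisimilar s t) ∧
      ((s, t) ∉ σ.notBisim → b = true → σ'.Related P s t) := by
  induction n generalizing P s t σ with
  | zero => exact Nat.zero_le _
  | succ n ih =>
    refine spec_matchBody (fun s' t' σ' hσ' hv' hn' => ?_) hσ hv
    have h := ih hσ' hv'
    unfold Spec at h ⊢
    cases h' : matchStates E n s' t' σ' with
    | outOfFuel => simpa only [h'] using h
    | wrongAssumption σ'' => simpa only [h'] using h
    | ret b σ'' =>
      simp only [h'] at h ⊢
      -- `CallSpec` concerns only pairs outside `notBisim`, so here relatedness is available.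
      exact ⟨h.1, h.2.1, h.2.2.2.2 hn', h.2.2.2.1⟩

/-- Pairs that match each other up to a successful run of `Bis` are bisimilar. -/
theorem _root_.Store.Valid.bisimilar {σ : Store S} (hσ : σ.Valid L ∅) {s t : S}
    (h : ∀ a, L.MatchesAction (σ.Related ∅) s t a) : L.Bisimilar s t := by
  have hr : ∀ u w, σ.Related ∅ u w → ∀ a, L.MatchesAction (σ.Related ∅) u w a := by
    rintro u w (ha | ⟨hu, hn, hP⟩)
    · exact hσ.matchesAction u w (hσ.mem_visited _ ha) (hσ.notMem_notBisim _ ha) (by simp)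
    · exact hσ.matchesAction u w hu hn hP
  -- The root pair is adjoined because it is only known to match, not to be related.
  refine ⟨fun u w => σ.Related ∅ u w ∨ (u, w) = (s, t), isBisimulation_iff.2 ?_, Or.inr rfl⟩
  rintro u w (hu | hu) a
  · exact (hr u w hu a).mono fun _ _ => Or.inl
  · cases hu
    exact (h a).mono fun _ _ => Or.inl

/-- `Bis` only returns correct answers, and it returns an answer if it may be restarted often
enough. -/
theorem bis_spec [Fintype S] (n : ℕ) (s t : S) (σ : Store S) (hσ : σ.Sound L) :
    match bis E n s t σ with
    | .outOfFuel => n ≤ (Set.univ : Set (S × S)).ncard + σ.notBisimᶜ.ncard + 1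
    | .wrongAssumption _ => False
    | .ret b _ => (b = true ↔ L.Bisimilar s t) := by
  induction n generalizing σ with
  | zero => exact Nat.zero_le _
  | succ n ih =>
    have hσ₀ : Store.Valid L ∅ { σ with visited := ∅, assumed := ∅ } :=
      ⟨hσ, by simp, by simp, by simp, by simp⟩
    have h := spec_matchStates (E := E) n hσ₀ (s := s) (t := t) (by simp)
    unfold Spec at h
    rw [bis]
    cases hm : matchStates E n s t { σ with visited := ∅, assumed := ∅ } with
    | outOfFuel =>
      simp only [hm, Set.compl_empty] at h ⊢
      omega
    | wrongAssumption σ' =>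
      simp only [hm] at h ⊢
      -- This decrease pays for the unit of `n` that a restart consumes.
      have hlt : σ'.notBisimᶜ.ncard < σ.notBisimᶜ.ncard := by
        obtain ⟨hs, x, hx, hx'⟩ := Set.ssubset_iff_exists.1 h.1
        exact Set.ncard_lt_ncard (Set.ssubset_iff_exists.2
          ⟨Set.compl_subset_compl.2 hs, x, hx', fun hn => hn hx⟩) (Set.toFinite _)
      have := ih σ' h.2
      cases hb : bis E n s t σ' with
      | outOfFuel =>
        simp only [hb] at this ⊢
        omega
      | wrongAssumption σ'' => simp only [hb] at this
      | ret b σ'' => simpa only [hb] using this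
    | ret b σ' =>
      simp only [hm] at h ⊢
      refine ⟨fun hb => h.1.bisimilar (h.2.2.1 hb), fun hst => ?_⟩
      by_contra hb
      exact h.2.2.2.1 (by simpa using hb) hst

theorem BisimReturns.eq_true_iff [Fintype S] {s t : S} {b : Bool} (h : BisimReturns E s t b) :
    b = true ↔ L.Bisimilar s t := by
  obtain ⟨n, σ, h⟩ := h
  have := bis_spec (E := E) n s t { notBisim := ∅, visited := ∅, assumed := ∅ }
    fun _ _ h => absurd h (by simp)
  simpa only [h] using this

theorem exists_bisimReturns [Fintype S] (E : L.Enumeration) (s t : S) :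
    ∃ b, BisimReturns E s t b := by
  let σ : Store S := { notBisim := ∅, visited := ∅, assumed := ∅ }
  -- One more than the largest bound at which `bis_spec` allows running out of fuel.
  let n := (Set.univ : Set (S × S)).ncard + σ.notBisimᶜ.ncard + 2
  have := bis_spec (E := E) n s t σ fun _ _ h => absurd h (by simp [σ])
  cases h : bis E n s t σ with
  | outOfFuel =>
    simp only [h] at this
    omega
  | wrongAssumption σ' => simp only [h] at this
  | ret b σ' => exact ⟨b, n, σ', h⟩

end PLTS

/-- For every order in which the loops are run, `Bisim(s₀, t₀)` terminates with exactly one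
result, and this result is `true` if and only if `s₀` and `t₀` are bisimilar. -/
theorem theoremt {S : Type u} {Act : Type v} [Fintype S] (L : PLTS S Act) (hL : L.Finitary)
    (E : L.Enumeration) (s₀ t₀ : S) :
    (∃! b : Bool, PLTS.BisimReturns E s₀ t₀ b) ∧
      (PLTS.BisimReturns E s₀ t₀ true ↔ L.Bisimilar s₀ t₀) := by
  obtain ⟨b, hb⟩ := PLTS.exists_bisimReturns E s₀ t₀
  refine ⟨⟨b, hb, fun b' hb' => ?_⟩, fun h => h.eq_true_iff.1 rfl, fun h => ?_⟩
  -- Both results decide bisimilarity, so they agree whatever bounds produced them.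
  · exact Bool.eq_iff_iff.2 (hb'.eq_true_iff.trans hb.eq_true_iff.symm)
  · exact hb.eq_true_iff.2 h ▸ hb
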